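/- Let $M$ be a $C^\infty$ manifold of dimension $m$ with a smooth Poisson tensor, that is, a smooth skew-symmetric tensor field $h^{ij}$ whose bracket $\{f,g\}=h^{ij}\,\partial_i f\,\partial_j g$ on (local) smooth functions satisfies the Jacobi identity, and let $x_0\in M$. Splitting coordinates at $x_0$ are local $C^\infty$ coordinates $(x^1,\dots,x^{2n},y^1,\dots,y^k)$, $2n+k=m$, on an open neighbourhood of $x_0$, with $x_0$ as origin, such that $$\{x^i,x^{n+j}\}=\delta^{ij}\ (1\le i,j\le n),\qquad \{y^p,y^q\}=h^{pq}(y)\ (1\le p,q\le k),\qquad h^{pq}(0)=0,$$ where $h^{pq}$ depends on $y$ only, and all other brackets of coordinates vanish (apart from those given by skew-symmetry). 1. For all splitting coordinates at $x_0$ there are unique real numbers $C^{pq}_r$ with $h^{pq}(y)=\sum_r C^{pq}_r\,y^r+O(|y|^2)$ as $y\to0$, and they are the structure constants of a $k$-dimensional real Lie algebra $L$: it has a basis $e^1,\dots,e^k$ with $[e^p,e^q]=\sum_r C^{pq}_r\,e^r$. 2. The Lie algebra $L$ is an invariant of the Poisson tensor at the point $x_0$: any two systems of splitting coordinates at $x_0$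 (a priori with different $n$ and $k$) yield isomorphic Lie algebras. -/

import Mathlib

open scoped Manifold ContDiff Topology

/-- The cotangent space `T*_z M` of a manifold modelled on `ℝ^m`. -/
abbrev CotangentSpaceAt (m : ℕ) (M : Type*) [TopologicalSpace M]
    [ChartedSpace (EuclideanSpace ℝ (Fin m)) M] (z : M) : Type :=
  TangentSpace (𝓡 m) z →L[ℝ] ℝ

/-- The differential `df_z ∈ T*_z M` of a real function. -/
noncomputable def differentialAt {m : ℕ} {M : Type*} [TopologicalSpace M]
    [ChartedSpace (EuclideanSpace ℝ (Fin m)) M] (f : M → ℝ) (z : M) :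
    CotangentSpaceAt m M z :=
  mfderiv (𝓡 m) 𝓘(ℝ, ℝ) f z

/-- The bracket `{f, g}(z) = h_z(df_z, dg_z)`, that is `h^{ij} ∂_i f ∂_j g` in coordinates, of a
field `h` of bilinear forms on the cotangent spaces. -/
noncomputable def tensorBracket {m : ℕ} {M : Type*} [TopologicalSpace M]
    [ChartedSpace (EuclideanSpace ℝ (Fin m)) M]
    (h : ∀ z : M, CotangentSpaceAt m M z →ₗ[ℝ] CotangentSpaceAt m M z →ₗ[ℝ] ℝ)
    (f g : M → ℝ) : M → ℝ :=
  fun z => h z (differentialAt f z) (differentialAt g z)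

/-- A (smooth) Poisson tensor on a manifold `M` of dimension `m`: a skew-symmetric field of bilinear
forms on the cotangent spaces, which is smooth (brackets of local smooth functions are smooth; on
coordinate functions this says that the components `h^{ij}` are smooth), and whose bracket
satisfies the Jacobi identity on local smooth functions. The Leibniz rule is automatic. -/
structure PoissonTensor (m : ℕ) (M : Type*) [TopologicalSpace M]
    [ChartedSpace (EuclideanSpace ℝ (Fin m)) M] where
  /-- The tensor at each point. -/
  tensor : ∀ z : M, CotangentSpaceAt m M z →ₗ[ℝ] CotangentSpaceAt m M z →ₗ[ℝ] ℝ
  skew : ∀ (z : M) (α β : CotangentSpaceAt m M z), tensor z α β = -tensor z β α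
  smooth : ∀ (U : Set M), IsOpen U → ∀ f g : M → ℝ,
    ContMDiffOn (𝓡 m) 𝓘(ℝ, ℝ) ∞ f U → ContMDiffOn (𝓡 m) 𝓘(ℝ, ℝ) ∞ g U →
    ContMDiffOn (𝓡 m) 𝓘(ℝ, ℝ) ∞ (tensorBracket tensor f g) U
  jacobi : ∀ (U : Set M), IsOpen U → ∀ f g k : M → ℝ,
    ContMDiffOn (𝓡 m) 𝓘(ℝ, ℝ) ∞ f U → ContMDiffOn (𝓡 m) 𝓘(ℝ, ℝ) ∞ g U →
    ContMDiffOn (𝓡 m) 𝓘(ℝ, ℝ) ∞ k U → ∀ z ∈ U,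
      tensorBracket tensor (tensorBracket tensor f g) k z
        + tensorBracket tensor (tensorBracket tensor g k) f z
        + tensorBracket tensor (tensorBracket tensor k f) g z = 0

/-- The Poisson bracket of two functions. -/
noncomputable def PoissonTensor.bracket {m : ℕ} {M : Type*} [TopologicalSpace M]
    [ChartedSpace (EuclideanSpace ℝ (Fin m)) M] (P : PoissonTensor m M) (f g : M → ℝ) : M → ℝ :=
  tensorBracket P.tensor f g

/-- Local splitting coordinates `(x^1, …, x^{2n}, y^1, …, y^k)` of a Poisson tensor, centred at
the point `x₀`, together with the transverse Poisson tensor `h^{pq}(y)`.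
The `m` coordinates of the chart are labelled by `e`: the labels `inl (inl i)`, `inl (inr i)` and
`inr p` stand for `x^i`, `x^{n+i}` and `y^p`. -/
structure SplittingCoordinates {m : ℕ} {M : Type*} [TopologicalSpace M]
    [ChartedSpace (EuclideanSpace ℝ (Fin m)) M] (P : PoissonTensor m M) (x₀ : M) (n k : ℕ) where
  /-- The chart. -/
  chart : OpenPartialHomeomorph M (EuclideanSpace ℝ (Fin m))
  chart_mem : chart ∈ IsManifold.maximalAtlas (𝓡 m) ∞ M
  mem_source : x₀ ∈ chart.source
  centred : chart x₀ = 0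
  /-- The labelling of the coordinates. -/
  e : (Fin n ⊕ Fin n) ⊕ Fin k ≃ Fin m
  /-- The transverse Poisson tensor, as a function of `y`. -/
  h : Fin k → Fin k → EuclideanSpace ℝ (Fin k) → ℝ
  bracket_x_x : ∀ i j : Fin n, ∀ z ∈ chart.source,
    P.bracket (fun w => chart w (e (.inl (.inl i)))) (fun w => chart w (e (.inl (.inl j)))) z = 0
  bracket_x_x' : ∀ i j : Fin n, ∀ z ∈ chart.source,
    P.bracket (fun w => chart w (e (.inl (.inl i)))) (fun w => chart w (e (.inl (.inr j)))) z
      = if i = j then 1 else 0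
  bracket_x'_x' : ∀ i j : Fin n, ∀ z ∈ chart.source,
    P.bracket (fun w => chart w (e (.inl (.inr i)))) (fun w => chart w (e (.inl (.inr j)))) z = 0
  bracket_x_y : ∀ (i : Fin n ⊕ Fin n) (p : Fin k), ∀ z ∈ chart.source,
    P.bracket (fun w => chart w (e (.inl i))) (fun w => chart w (e (.inr p))) z = 0
  bracket_y_y : ∀ p q : Fin k, ∀ z ∈ chart.source,
    P.bracket (fun w => chart w (e (.inr p))) (fun w => chart w (e (.inr q))) z
      = h p q (WithLp.toLp 2 fun r => chart z (e (.inr r)))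
  h_zero : ∀ p q : Fin k, h p q 0 = 0

/-- `h^{pq}(y) = C^{pq}_r y^r + O(|y|^2)` as `y → 0`. -/
def IsLinearPart {k : ℕ} (h : Fin k → Fin k → EuclideanSpace ℝ (Fin k) → ℝ)
    (C : Fin k → Fin k → Fin k → ℝ) : Prop :=
  ∀ p q : Fin k, (fun y : EuclideanSpace ℝ (Fin k) => h p q y - ∑ r, C p q r * y r)
    =O[𝓝 0] fun y => ‖y‖ ^ 2

/-- The basis `b` of the Lie algebra `L` has the structure constants `C`:
`[b^p, b^q] = C^{pq}_r b^r`. -/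
def HasStructureConstants {k : ℕ} {L : Type*} [LieRing L] [LieAlgebra ℝ L]
    (b : Module.Basis (Fin k) ℝ L) (C : Fin k → Fin k → Fin k → ℝ) : Prop :=
  ∀ p q : Fin k, ⁅b p, b q⁆ = ∑ r, C p q r • b r

/-! Let `K` be the kernel of the Poisson tensor in the cotangent space at `x₀`. It carries a bracket
`[df, dg] = d{f, g}` defined without coordinates, and `L` is `K` written in a basis.

The bracket is well defined (`differentialAt_bracket_congr`): near the point `{f, g} = ∂_a f {x^a,
g}`. If `df = 0` and `dg ∈ K` at the point, both factors vanish there, so the product rule gives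
`d{f, g} = 0`. Skew-symmetry and the Jacobi identity are inherited from the Poisson bracket.

In splitting coordinates the `dy^p` form a basis of `K` (`linearIndependent_dy`, `span_dy`), because
the `x`-block of the tensor at `x₀` is the standard symplectic matrix and all other entries vanish.
Differentiating `{y^p, y^q} = h^{pq}(y)` gives `[dy^p, dy^q] = C^{pq}_r dy^r`
(`differentialAt_bracket_y`). So every splitting system describes the same `K`, which yields both
the Lie algebra axioms and the isomorphism. The linear part exists and is unique by Taylor's formula
for `h`. -/

/-! ### Differentials of functions and their expansion in a chart -/

section Differentials

variable {m : ℕ} {M : Type*} [TopologicalSpace M] [ChartedSpace (EuclideanSpace ℝ (Fin m)) M]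

/-- The function `f` is smooth on a neighbourhood of `x`. -/
def SmoothNear (m : ℕ) {M : Type*} [TopologicalSpace M]
    [ChartedSpace (EuclideanSpace ℝ (Fin m)) M] (f : M → ℝ) (x : M) : Prop :=
  ∀ᶠ z in 𝓝 x, ContMDiffAt (𝓡 m) 𝓘(ℝ, ℝ) ∞ f z

theorem SmoothNear.mdifferentiableAt {f : M → ℝ} {x : M} (hf : SmoothNear m f x) :
    MDifferentiableAt (𝓡 m) 𝓘(ℝ, ℝ) f x :=
  hf.self_of_nhds.mdifferentiableAt (by simp)

theorem SmoothNear.sub {f g : M → ℝ} {x : M} (hf : SmoothNear m f x) (hg : SmoothNear m g x) :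
    SmoothNear m (fun w => f w - g w) x := by
  filter_upwards [hf, hg] with z h1 h2 using h1.sub h2

theorem SmoothNear.sum_mul {ι : Type} [Fintype ι] (c : ι → ℝ) {f : ι → M → ℝ} {x : M}
    (hf : ∀ i, SmoothNear m (f i) x) : SmoothNear m (fun w => ∑ i, c i * f i w) x := by
  filter_upwards [Filter.eventually_all.2 hf] with z hz
  exact ContMDiffAt.sum fun i _ => contMDiffAt_const.mul (hz i)

theorem differentialAt_congr {f g : M → ℝ} {x : M} (h : f =ᶠ[𝓝 x] g) :
    differentialAt (m := m) f x = differentialAt g x :=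
  h.mfderiv_eq

theorem differentialAt_sub {f g : M → ℝ} {x : M} (hf : MDifferentiableAt (𝓡 m) 𝓘(ℝ, ℝ) f x)
    (hg : MDifferentiableAt (𝓡 m) 𝓘(ℝ, ℝ) g x) :
    differentialAt (m := m) (fun w => f w - g w) x = differentialAt f x - differentialAt g x :=
  (hf.hasMFDerivAt.sub hg.hasMFDerivAt).mfderiv

theorem differentialAt_sum_mul {ι : Type} [Fintype ι] (c : ι → ℝ) {f : ι → M → ℝ} {x : M}
    (hf : ∀ i, MDifferentiableAt (𝓡 m) 𝓘(ℝ, ℝ) (f i) x) :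
    differentialAt (m := m) (fun w => ∑ i, c i * f i w) x = ∑ i, c i • differentialAt (f i) x := by
  have hi : ∀ i ∈ Finset.univ, HasMFDerivAt (𝓡 m) 𝓘(ℝ, ℝ) (c i • f i) x
      (c i • differentialAt (m := m) (f i) x) :=
    fun i _ => (hf i).hasMFDerivAt.const_smul (c i)
  have h := HasMFDerivAt.sum (f := fun i => c i • f i)
    (f' := fun i => c i • differentialAt (m := m) (f i) x) hi
  have e : (∑ i, c i • f i) = fun w => ∑ i, c i * f i w := by
    ext w; simp
  rw [e] at h
  exact h.mfderiv

/-- A sum of products of pairs of functions that vanish at `x` has zero differential at `x`. -/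
theorem differentialAt_sum_mul_eq_zero {ι : Type} [Fintype ι] {u v : ι → M → ℝ} {x : M}
    (hu : ∀ i, MDifferentiableAt (𝓡 m) 𝓘(ℝ, ℝ) (u i) x)
    (hv : ∀ i, MDifferentiableAt (𝓡 m) 𝓘(ℝ, ℝ) (v i) x)
    (hu0 : ∀ i, u i x = 0) (hv0 : ∀ i, v i x = 0) :
    differentialAt (m := m) (fun w => ∑ i, u i w * v i w) x = 0 := by
  have hi : ∀ i ∈ Finset.univ, HasMFDerivAt (𝓡 m) 𝓘(ℝ, ℝ) (u i * v i) x
      (0 : CotangentSpaceAt m M x) := by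
    intro i _
    have h : HasMFDerivAt (𝓡 m) 𝓘(ℝ, ℝ) (u i * v i) x
        (u i x • differentialAt (m := m) (v i) x + v i x • differentialAt (m := m) (u i) x) :=
      (hu i).hasMFDerivAt.mul (hv i).hasMFDerivAt
    rwa [hu0 i, hv0 i, zero_smul, zero_smul, add_zero] at h
  have h := HasMFDerivAt.sum (f := fun i => u i * v i)
    (f' := fun _ => (0 : CotangentSpaceAt m M x)) hi
  have e : (∑ i, u i * v i) = fun w => ∑ i, u i w * v i w := by
    ext w; simp
  rw [e] at h
  exact h.mfderiv.trans Finset.sum_const_zero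

/-- The differential of a map to `ℝ^m`, as a linear map to `ℝ^m`. -/
noncomputable def vectorDifferentialAt (ψ : M → EuclideanSpace ℝ (Fin m)) (x : M) :
    TangentSpace (𝓡 m) x →L[ℝ] EuclideanSpace ℝ (Fin m) :=
  mfderiv (𝓡 m) (𝓡 m) ψ x

variable {φ : OpenPartialHomeomorph M (EuclideanSpace ℝ (Fin m))}

theorem mdifferentiable_of_mem_maximalAtlas [IsManifold (𝓡 m) ∞ M]
    (hφ : φ ∈ IsManifold.maximalAtlas (𝓡 m) ∞ M) : φ.MDifferentiable (𝓡 m) (𝓡 m) :=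
  ⟨(contMDiffOn_of_mem_maximalAtlas hφ).mdifferentiableOn (by simp),
    (contMDiffOn_symm_of_mem_maximalAtlas hφ).mdifferentiableOn (by simp)⟩

theorem differentialAt_comp {G : EuclideanSpace ℝ (Fin m) → ℝ}
    {G' : EuclideanSpace ℝ (Fin m) →L[ℝ] ℝ} {ψ : M → EuclideanSpace ℝ (Fin m)} {x : M}
    (hψ : MDifferentiableAt (𝓡 m) (𝓡 m) ψ x) (hG : HasFDerivAt G G' (ψ x)) :
    differentialAt (m := m) (fun w => G (ψ w)) x = G'.comp (vectorDifferentialAt ψ x) :=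
  (HasMFDerivAt.comp x hG.hasMFDerivAt hψ.hasMFDerivAt).mfderiv

theorem differentialAt_coord {ψ : M → EuclideanSpace ℝ (Fin m)} {x : M}
    (hψ : MDifferentiableAt (𝓡 m) (𝓡 m) ψ x) (a : Fin m) :
    differentialAt (m := m) (fun w => ψ w a) x =
      (EuclideanSpace.proj a : EuclideanSpace ℝ (Fin m) →L[ℝ] ℝ).comp
        (vectorDifferentialAt ψ x) :=
  differentialAt_comp hψ (EuclideanSpace.proj a : EuclideanSpace ℝ (Fin m) →L[ℝ] ℝ).hasFDerivAt

theorem EuclideanSpace.clm_eq_sum_proj {n : ℕ} (l : EuclideanSpace ℝ (Fin n) →L[ℝ] ℝ) :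
    l = ∑ a, l (EuclideanSpace.single a 1) •
      (EuclideanSpace.proj a : EuclideanSpace ℝ (Fin n) →L[ℝ] ℝ) := by
  ext v
  conv_lhs => rw [← (EuclideanSpace.basisFun (Fin n) ℝ).sum_repr v]
  simp [mul_comm]

theorem comp_mfderiv_eq_sum {ψ : M → EuclideanSpace ℝ (Fin m)} {x : M}
    (hψ : MDifferentiableAt (𝓡 m) (𝓡 m) ψ x) (l : EuclideanSpace ℝ (Fin m) →L[ℝ] ℝ) :
    (l.comp (vectorDifferentialAt ψ x) : CotangentSpaceAt m M x) =
      ∑ a, l (EuclideanSpace.single a 1) • differentialAt (fun w => ψ w a) x := by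
  simp_rw [differentialAt_coord hψ]
  conv_lhs => rw [EuclideanSpace.clm_eq_sum_proj l]
  ext v
  simp only [ContinuousLinearMap.comp_apply, _root_.sum_apply,
    _root_.smul_apply]

theorem smoothNear_coord (hφ : φ ∈ IsManifold.maximalAtlas (𝓡 m) ∞ M) {x : M}
    (hx : x ∈ φ.source) (a : Fin m) : SmoothNear m (fun w => φ w a) x := by
  filter_upwards [φ.open_source.mem_nhds hx] with z hz
  exact (EuclideanSpace.proj a : EuclideanSpace ℝ (Fin m) →L[ℝ] ℝ).contMDiff.contMDiffAt.comp z
    (contMDiffAt_of_mem_maximalAtlas hφ hz)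

variable [IsManifold (𝓡 m) ∞ M]

theorem exists_eq_sum_differentialAt_coord (hφ : φ ∈ IsManifold.maximalAtlas (𝓡 m) ∞ M) {x : M}
    (hx : x ∈ φ.source) (α : CotangentSpaceAt m M x) :
    ∃ c : Fin m → ℝ, α = ∑ a, c a • differentialAt (fun w => φ w a) x := by
  have hd := mdifferentiable_of_mem_maximalAtlas hφ
  let D := hd.mfderiv hx
  let l : EuclideanSpace ℝ (Fin m) →L[ℝ] ℝ := α.comp D.symm.toContinuousLinearMap
  refine ⟨fun a => l (EuclideanSpace.single a 1), ?_⟩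
  rw [← comp_mfderiv_eq_sum (hd.mdifferentiableAt hx) l]
  ext v
  exact congrArg α (D.symm_apply_apply v).symm

theorem linearIndependent_differentialAt_coord (hφ : φ ∈ IsManifold.maximalAtlas (𝓡 m) ∞ M)
    {x : M} (hx : x ∈ φ.source) :
    LinearIndependent ℝ fun a : Fin m => differentialAt (m := m) (fun w => φ w a) x := by
  have hd := mdifferentiable_of_mem_maximalAtlas hφ
  rw [Fintype.linearIndependent_iff]
  intro c hc a
  obtain ⟨v, hv⟩ : ∃ v, vectorDifferentialAt φ x v = EuclideanSpace.single a (1 : ℝ) :=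
    hd.mfderiv_surjective hx (EuclideanSpace.single a (1 : ℝ))
  have h := congrArg (fun α : CotangentSpaceAt m M x => α v) hc
  simp only [differentialAt_coord (hd.mdifferentiableAt hx), _root_.sum_apply,
    _root_.smul_apply, ContinuousLinearMap.comp_apply, hv] at h
  simpa [Pi.single_apply] using h

/-- In a chart, `df = ∂_a f dx^a`. -/
theorem differentialAt_eq_sum_coord (hφ : φ ∈ IsManifold.maximalAtlas (𝓡 m) ∞ M) {x : M}
    (hx : x ∈ φ.source) {f : M → ℝ} (hf : ContMDiffAt (𝓡 m) 𝓘(ℝ, ℝ) ∞ f x) :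
    differentialAt (m := m) f x = ∑ a, fderiv ℝ (fun y => f (φ.symm y)) (φ x)
      (EuclideanSpace.single a 1) • differentialAt (fun w => φ w a) x := by
  have hd := (mdifferentiable_of_mem_maximalAtlas hφ).mdifferentiableAt hx
  have hG : ContDiffAt ℝ ∞ (fun y => f (φ.symm y)) (φ x) := by
    refine ContMDiffAt.contDiffAt (ContMDiffAt.comp (φ x) ?_
      (contMDiffAt_symm_of_mem_maximalAtlas hφ (φ.map_source hx)))
    rwa [φ.left_inv hx]
  rw [← comp_mfderiv_eq_sum hd, ← differentialAt_comp hd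
    (hG.differentiableAt (by simp)).hasFDerivAt]
  refine differentialAt_congr ?_
  filter_upwards [φ.open_source.mem_nhds hx] with z hz
  rw [φ.left_inv hz]

/-- Allows the product rule to be applied to the expansion `{f, g} = ∂_a f {x^a, g}`. -/
theorem mdifferentiableAt_partial (hφ : φ ∈ IsManifold.maximalAtlas (𝓡 m) ∞ M) {x : M}
    (hx : x ∈ φ.source) {f : M → ℝ} (hf : ContMDiffAt (𝓡 m) 𝓘(ℝ, ℝ) ∞ f x)
    (v : EuclideanSpace ℝ (Fin m)) :
    MDifferentiableAt (𝓡 m) 𝓘(ℝ, ℝ)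
      (fun z => fderiv ℝ (fun y => f (φ.symm y)) (φ z) v) x := by
  have hd := (mdifferentiable_of_mem_maximalAtlas hφ).mdifferentiableAt hx
  have hG : ContDiffAt ℝ ∞ (fun y => f (φ.symm y)) (φ x) := by
    refine ContMDiffAt.contDiffAt (ContMDiffAt.comp (φ x) ?_
      (contMDiffAt_symm_of_mem_maximalAtlas hφ (φ.map_source hx)))
    rwa [φ.left_inv hx]
  have h1 : DifferentiableAt ℝ (fun y => fderiv ℝ (fun y => f (φ.symm y)) y v) (φ x) :=
    ((hG.fderiv_right (m := 1) (by decide)).differentiableAt (by simp)).clm_apply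
      (differentiableAt_const v)
  exact MDifferentiableAt.comp x h1.mdifferentiableAt hd

end Differentials

/-! ### The differential of a Poisson bracket at a point -/

namespace PoissonTensor

variable {m : ℕ} {M : Type*} [TopologicalSpace M] [ChartedSpace (EuclideanSpace ℝ (Fin m)) M]
  (P : PoissonTensor m M) {x : M} {f g f' g' : M → ℝ}

theorem _root_.SmoothNear.exists_isOpen (hf : SmoothNear m f x) :
    ∃ U : Set M, IsOpen U ∧ x ∈ U ∧ ContMDiffOn (𝓡 m) 𝓘(ℝ, ℝ) ∞ f U := by
  obtain ⟨U, hU, hUo, hx⟩ := eventually_nhds_iff.1 hf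
  exact ⟨U, hUo, hx, fun z hz => (hU z hz).contMDiffWithinAt⟩

theorem _root_.SmoothNear.bracket (hf : SmoothNear m f x) (hg : SmoothNear m g x) :
    SmoothNear m (P.bracket f g) x := by
  obtain ⟨U, hU, hxU, hfU⟩ := hf.exists_isOpen
  obtain ⟨V, hV, hxV, hgV⟩ := hg.exists_isOpen
  have h := P.smooth (U ∩ V) (hU.inter hV) f g (hfU.mono Set.inter_subset_left)
    (hgV.mono Set.inter_subset_right)
  filter_upwards [(hU.inter hV).mem_nhds ⟨hxU, hxV⟩] with z hz
  exact h.contMDiffAt ((hU.inter hV).mem_nhds hz)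

theorem bracket_skew (f g : M → ℝ) : P.bracket f g = fun z => -P.bracket g f z :=
  funext fun z => P.skew z _ _

theorem bracket_jacobi {k : M → ℝ} (hf : SmoothNear m f x) (hg : SmoothNear m g x)
    (hk : SmoothNear m k x) : ∀ᶠ z in 𝓝 x, P.bracket (P.bracket f g) k z
      + P.bracket (P.bracket g k) f z + P.bracket (P.bracket k f) g z = 0 := by
  obtain ⟨U, hU, hxU, hfU⟩ := hf.exists_isOpen
  obtain ⟨V, hV, hxV, hgV⟩ := hg.exists_isOpen
  obtain ⟨W, hW, hxW, hkW⟩ := hk.exists_isOpen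
  filter_upwards [((hU.inter hV).inter hW).mem_nhds ⟨⟨hxU, hxV⟩, hxW⟩] with z hz
  exact P.jacobi _ ((hU.inter hV).inter hW) f g k (hfU.mono fun _ h => h.1.1)
    (hgV.mono fun _ h => h.1.2) (hkW.mono fun _ h => h.2) z hz

theorem bracket_sub_left (hf : SmoothNear m f x) (hf' : SmoothNear m f' x) (g : M → ℝ) :
    P.bracket (fun w => f w - f' w) g =ᶠ[𝓝 x] fun z => P.bracket f g z - P.bracket f' g z := by
  filter_upwards [hf, hf'] with z h h'
  simp only [bracket, tensorBracket]
  rw [differentialAt_sub (h.mdifferentiableAt (by simp)) (h'.mdifferentiableAt (by simp)),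
    map_sub, LinearMap.sub_apply]

theorem bracket_sum_mul_left {ι : Type} [Fintype ι] (c : ι → ℝ) {u : ι → M → ℝ}
    (hu : ∀ i, SmoothNear m (u i) x) (g : M → ℝ) :
    P.bracket (fun w => ∑ i, c i * u i w) g =ᶠ[𝓝 x] fun z => ∑ i, c i * P.bracket (u i) g z := by
  filter_upwards [Filter.eventually_all.2 hu] with z hz
  simp only [bracket, tensorBracket]
  rw [differentialAt_sum_mul c fun i => (hz i).mdifferentiableAt (by simp)]
  simp [LinearMap.sum_apply]

theorem differentialAt_bracket_skew (f g : M → ℝ) :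
    differentialAt (m := m) (P.bracket f g) x = -differentialAt (P.bracket g f) x := by
  rw [P.bracket_skew f g]
  exact mfderiv_neg

theorem differentialAt_bracket_sum_left {ι : Type} [Fintype ι] (c : ι → ℝ) {u : ι → M → ℝ}
    (hu : ∀ i, SmoothNear m (u i) x) (hg : SmoothNear m g x) :
    differentialAt (m := m) (P.bracket (fun w => ∑ i, c i * u i w) g) x =
      ∑ i, c i • differentialAt (P.bracket (u i) g) x := by
  rw [differentialAt_congr (P.bracket_sum_mul_left c hu g),
    differentialAt_sum_mul c fun i => ((hu i).bracket P hg).mdifferentiableAt]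

theorem differentialAt_bracket_sum_right {ι : Type} [Fintype ι] (c : ι → ℝ) {u : ι → M → ℝ}
    (hu : ∀ i, SmoothNear m (u i) x) (hg : SmoothNear m g x) :
    differentialAt (m := m) (P.bracket g (fun w => ∑ i, c i * u i w)) x =
      ∑ i, c i • differentialAt (P.bracket g (u i)) x := by
  rw [differentialAt_bracket_skew, P.differentialAt_bracket_sum_left c hu hg,
    ← Finset.sum_neg_distrib]
  simp_rw [P.differentialAt_bracket_skew g, smul_neg]

variable [IsManifold (𝓡 m) ∞ M]

/-- If `df = 0` and `dg` lies in the kernel of the Poisson tensor at `x`, then `d{f, g} = 0`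
at `x`. -/
theorem differentialAt_bracket_eq_zero (hf : SmoothNear m f x) (hg : SmoothNear m g x)
    (hf0 : differentialAt (m := m) f x = 0)
    (hgK : differentialAt g x ∈ LinearMap.ker (P.tensor x)) :
    differentialAt (m := m) (P.bracket f g) x = 0 := by
  set φ := chartAt (EuclideanSpace ℝ (Fin m)) x with hφdef
  have hφ : φ ∈ IsManifold.maximalAtlas (𝓡 m) ∞ M := IsManifold.chart_mem_maximalAtlas x
  have hx : x ∈ φ.source := mem_chart_source _ x
  -- In this expansion `∂_a f` vanishes at `x` because `df = 0`, and `{x^a, g}` because `dg` is in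
  -- the kernel.
  have e : P.bracket f g =ᶠ[𝓝 x] fun z => ∑ a, fderiv ℝ (fun y => f (φ.symm y)) (φ z)
      (EuclideanSpace.single a 1) * P.bracket (fun w => φ w a) g z := by
    filter_upwards [hf, φ.open_source.mem_nhds hx] with z hz hzφ
    simp only [bracket, tensorBracket]
    rw [differentialAt_eq_sum_coord hφ hzφ hz]
    simp [LinearMap.sum_apply]
  rw [differentialAt_congr e]
  refine differentialAt_sum_mul_eq_zero
    (fun a => mdifferentiableAt_partial hφ hx hf.self_of_nhds _)
    (fun a => ((smoothNear_coord hφ hx a).bracket P hg).mdifferentiableAt) (fun a => ?_)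
    fun a => ?_
  · refine Fintype.linearIndependent_iff.1 (linearIndependent_differentialAt_coord hφ hx)
      (fun a => fderiv ℝ (fun y => f (φ.symm y)) (φ x) (EuclideanSpace.single a 1)) ?_ a
    rw [← differentialAt_eq_sum_coord hφ hx hf.self_of_nhds, hf0]
  · rw [bracket_skew]
    simp only [bracket, tensorBracket, LinearMap.mem_ker.1 hgK, LinearMap.zero_apply, neg_zero]

/-- On functions whose differentials lie in the kernel of the Poisson tensor at `x`, the
differential of the bracket depends only on the differentials at `x`. -/
theorem differentialAt_bracket_congr (hf : SmoothNear m f x) (hf' : SmoothNear m f' x)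
    (hg : SmoothNear m g x) (hg' : SmoothNear m g' x)
    (hff' : differentialAt (m := m) f x = differentialAt f' x)
    (hgg' : differentialAt (m := m) g x = differentialAt g' x)
    (hfK : differentialAt f x ∈ LinearMap.ker (P.tensor x))
    (hgK : differentialAt g x ∈ LinearMap.ker (P.tensor x)) :
    differentialAt (m := m) (P.bracket f g) x = differentialAt (P.bracket f' g') x := by
  have key : ∀ {a a' b : M → ℝ}, SmoothNear m a x → SmoothNear m a' x → SmoothNear m b x →
      differentialAt (m := m) a x = differentialAt a' x →
      differentialAt b x ∈ LinearMap.ker (P.tensor x) →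
      differentialAt (m := m) (P.bracket a b) x = differentialAt (P.bracket a' b) x := by
    intro a a' b ha ha' hb haa' hbK
    have h := P.differentialAt_bracket_eq_zero (ha.sub ha') hb
      (by rw [differentialAt_sub ha.mdifferentiableAt ha'.mdifferentiableAt, haa', sub_self]) hbK
    rwa [differentialAt_congr (P.bracket_sub_left ha ha' b),
      differentialAt_sub (ha.bracket P hb).mdifferentiableAt (ha'.bracket P hb).mdifferentiableAt,
      sub_eq_zero] at h
  -- `key` replaces the first argument only; skew-symmetry brings the second one into its place.
  rw [key hf hf' hg hff' hgK, differentialAt_bracket_skew,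
    key hg hg' hf' hgg' (hff' ▸ hfK), ← differentialAt_bracket_skew]

end PoissonTensor

/-! ### Linear part of a tensor vanishing at the origin -/

section LinearPart

/-- Mean value inequality on the closed ball of radius `‖y‖`: there the derivative differs from its
value at `0` by at most `c * ‖y‖`, since it is itself differentiable at `0`. -/
theorem ContDiffAt.isBigO_sub_fderiv {E : Type*} [NormedAddCommGroup E] [NormedSpace ℝ E]
    {f : E → ℝ} (hf : ContDiffAt ℝ 2 f 0) :
    (fun y => f y - f 0 - fderiv ℝ f 0 y) =O[𝓝 0] fun y => ‖y‖ ^ 2 := by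
  have hd : ∀ᶠ y in 𝓝 (0 : E), DifferentiableAt ℝ f y :=
    (hf.eventually (by simp)).mono fun y hy => hy.differentiableAt (by simp)
  have hd' : DifferentiableAt ℝ (fderiv ℝ f) 0 :=
    (hf.fderiv_right (m := 1) (by norm_num)).differentiableAt (by simp)
  obtain ⟨c, hc⟩ := hd'.isBigO_sub.bound
  obtain ⟨ε, hε, hball⟩ := Metric.eventually_nhds_iff_ball.1 (hd.and hc)
  refine Asymptotics.IsBigO.of_bound c ?_
  filter_upwards [Metric.ball_mem_nhds (0 : E) hε] with y hy
  have hsub : ∀ z ∈ Metric.closedBall (0 : E) ‖y‖, z ∈ Metric.ball (0 : E) ε := by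
    intro z hz
    rw [mem_closedBall_zero_iff] at hz
    rw [mem_ball_zero_iff] at hy ⊢
    exact hz.trans_lt hy
  have hc0 : 0 ≤ c * ‖y‖ := by
    simpa using (norm_nonneg _).trans (hball y hy).2
  have h := (convex_closedBall (0 : E) ‖y‖).norm_image_sub_le_of_norm_fderiv_le' (𝕜 := ℝ)
    (f := f) (φ := fderiv ℝ f 0) (C := c * ‖y‖) (x := 0) (y := y)
    (fun z hz => (hball z (hsub z hz)).1) (fun z hz => ?_) (by simp) (by simp)
  · simpa [pow_two, mul_assoc] using h
  · rcases le_or_gt 0 c with hc' | hc'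
    · refine ((hball z (hsub z hz)).2).trans (mul_le_mul_of_nonneg_left ?_ hc')
      simpa using hz
    -- The constant `c` comes without a sign; if it is negative, `hc0` forces `y = 0`.
    · have hy0 : ‖y‖ = 0 := le_antisymm (by nlinarith [norm_nonneg y]) (norm_nonneg y)
      have hz0 : z = 0 := by simpa [hy0] using hz
      simp [hz0, hy0]

variable {k : ℕ} {h : Fin k → Fin k → EuclideanSpace ℝ (Fin k) → ℝ}
  {C C' : Fin k → Fin k → Fin k → ℝ}

/-- An error `O(|y|^2)` is `o(|y|)`, so the `C p q r` are the partial derivatives of `h p q` at `0`.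
-/
theorem IsLinearPart.hasFDerivAt (hC : IsLinearPart h C) (h0 : ∀ p q, h p q 0 = 0) (p q : Fin k) :
    HasFDerivAt (h p q) (∑ r, C p q r •
      (EuclideanSpace.proj r : EuclideanSpace ℝ (Fin k) →L[ℝ] ℝ)) 0 := by
  rw [hasFDerivAt_iff_isLittleO]
  have h1 := (hC p q).trans_isLittleO
    (Asymptotics.isLittleO_norm_pow_id (E' := EuclideanSpace ℝ (Fin k)) one_lt_two)
  simpa [h0, sum_apply] using h1

theorem IsLinearPart.unique (hC : IsLinearPart h C) (hC' : IsLinearPart h C')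
    (h0 : ∀ p q, h p q 0 = 0) : C = C' := by
  funext p q r
  have h1 := DFunLike.congr_fun ((hC.hasFDerivAt h0 p q).unique (hC'.hasFDerivAt h0 p q))
    (EuclideanSpace.single r (1 : ℝ))
  simpa [sum_apply, Pi.single_apply] using h1

theorem isLinearPart_fderiv (hh : ∀ p q, ContDiffAt ℝ 2 (h p q) 0) (h0 : ∀ p q, h p q 0 = 0) :
    IsLinearPart h fun p q r => fderiv ℝ (h p q) 0 (EuclideanSpace.single r 1) := by
  intro p q
  have h1 := (hh p q).isBigO_sub_fderiv
  rw [EuclideanSpace.clm_eq_sum_proj (fderiv ℝ (h p q) 0)] at h1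
  simpa [h0, sum_apply] using h1

end LinearPart

/-! ### Splitting coordinates and the kernel of the tensor -/

namespace SplittingCoordinates

variable {m : ℕ} {M : Type*} [TopologicalSpace M] [ChartedSpace (EuclideanSpace ℝ (Fin m)) M]
  {P : PoissonTensor m M} {x₀ : M} {n k : ℕ} (S : SplittingCoordinates P x₀ n k)

/-- The function `y^p`. -/
def y (p : Fin k) : M → ℝ := fun w => S.chart w (S.e (.inr p))

/-- The covector `dy^p` at the centre. -/
noncomputable def dy (p : Fin k) : CotangentSpaceAt m M x₀ := differentialAt (S.y p) x₀

theorem smoothNear_y (p : Fin k) : SmoothNear m (S.y p) x₀ :=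
  smoothNear_coord S.chart_mem S.mem_source _

/-- The inclusion of the transversal `x = 0`. -/
noncomputable def transversal : EuclideanSpace ℝ (Fin k) →L[ℝ] EuclideanSpace ℝ (Fin m) :=
  ∑ r, (EuclideanSpace.proj r : EuclideanSpace ℝ (Fin k) →L[ℝ] ℝ).smulRight
    (EuclideanSpace.single (S.e (.inr r)) (1 : ℝ))

theorem transversal_apply (v : EuclideanSpace ℝ (Fin k)) (r : Fin k) :
    S.transversal v (S.e (.inr r)) = v r := by
  simp [transversal, sum_apply, Pi.single_apply]

/-- The projection to the coordinates `y`. -/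
noncomputable def projection : EuclideanSpace ℝ (Fin m) →L[ℝ] EuclideanSpace ℝ (Fin k) :=
  ∑ r, (EuclideanSpace.proj (S.e (.inr r)) : EuclideanSpace ℝ (Fin m) →L[ℝ] ℝ).smulRight
    (EuclideanSpace.single r (1 : ℝ))

theorem projection_apply (v : EuclideanSpace ℝ (Fin m)) :
    S.projection v = WithLp.toLp 2 fun r => v (S.e (.inr r)) := by
  ext r
  simp [projection, sum_apply, Pi.single_apply]

theorem tensor_dx_dy (i : Fin n ⊕ Fin n) (p : Fin k) :
    P.tensor x₀ (differentialAt (fun w => S.chart w (S.e (.inl i))) x₀) (S.dy p) = 0 :=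
  S.bracket_x_y i p x₀ S.mem_source

theorem tensor_dy_dy (p q : Fin k) : P.tensor x₀ (S.dy p) (S.dy q) = 0 := by
  refine (S.bracket_y_y p q x₀ S.mem_source).trans ?_
  rw [S.centred]
  exact S.h_zero p q

/-- Smoothness of `h` is not part of the data: near `0`, `h p q` is the smooth function `{y^p, y^q}`
restricted to the transversal `x = 0`. -/
theorem contDiffAt_h (p q : Fin k) : ContDiffAt ℝ 2 (S.h p q) 0 := by
  have hy : ContMDiffAt (𝓡 m) 𝓘(ℝ, ℝ) ∞ (P.bracket (S.y p) (S.y q)) x₀ :=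
    ((S.smoothNear_y p).bracket P (S.smoothNear_y q)).self_of_nhds
  have hs : S.chart.symm 0 = x₀ := by
    rw [← S.centred, S.chart.left_inv S.mem_source]
  have ht : (0 : EuclideanSpace ℝ (Fin m)) ∈ S.chart.target := by
    rw [← S.centred]; exact S.chart.map_source S.mem_source
  have hG : ContDiffAt ℝ ∞ (fun v => P.bracket (S.y p) (S.y q) (S.chart.symm v)) 0 := by
    refine ContMDiffAt.contDiffAt (ContMDiffAt.comp 0 ?_
      (contMDiffAt_symm_of_mem_maximalAtlas S.chart_mem ht))
    rwa [hs]
  have hG' : ContDiffAt ℝ ∞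
      (fun v => P.bracket (S.y p) (S.y q) (S.chart.symm (S.transversal v))) 0 := by
    refine ContDiffAt.comp
      (g := fun v => P.bracket (S.y p) (S.y q) (S.chart.symm v)) 0 ?_ S.transversal.contDiff.contDiffAt
    rwa [map_zero]
  refine (hG'.congr_of_eventuallyEq ?_).of_le (by decide)
  have hn : ∀ᶠ v in 𝓝 (0 : EuclideanSpace ℝ (Fin k)), S.transversal v ∈ S.chart.target := by
    refine S.transversal.continuous.continuousAt.eventually_mem ?_
    rw [map_zero]
    exact S.chart.open_target.mem_nhds ht
  filter_upwards [hn] with v hv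
  refine Eq.trans ?_ (S.bracket_y_y p q _ (S.chart.map_target hv)).symm
  simp_rw [S.chart.right_inv hv, transversal_apply]

theorem existsUnique_isLinearPart : ∃! C : Fin k → Fin k → Fin k → ℝ, IsLinearPart S.h C :=
  ⟨_, isLinearPart_fderiv S.contDiffAt_h S.h_zero,
    fun _ hC => hC.unique (isLinearPart_fderiv S.contDiffAt_h S.h_zero) S.h_zero⟩

variable [IsManifold (𝓡 m) ∞ M]

/-- Chain rule for `h p q` composed with the coordinates `y`. This reads the constants `C` as
structure constants on the kernel. -/
theorem differentialAt_bracket_y {C : Fin k → Fin k → Fin k → ℝ} (hC : IsLinearPart S.h C)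
    (p q : Fin k) :
    differentialAt (m := m) (P.bracket (S.y p) (S.y q)) x₀ = ∑ r, C p q r • S.dy r := by
  have hd := (mdifferentiable_of_mem_maximalAtlas S.chart_mem).mdifferentiableAt S.mem_source
  have e : P.bracket (S.y p) (S.y q) =ᶠ[𝓝 x₀] fun z => S.h p q (S.projection (S.chart z)) := by
    filter_upwards [S.chart.open_source.mem_nhds S.mem_source] with z hz
    rw [projection_apply]
    exact S.bracket_y_y p q z hz
  have hh := hC.hasFDerivAt S.h_zero p q
  have hG : HasFDerivAt (fun v => S.h p q (S.projection v))
      ((∑ r, C p q r • (EuclideanSpace.proj r : EuclideanSpace ℝ (Fin k) →L[ℝ] ℝ)).comp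
        S.projection) (S.chart x₀) := by
    refine HasFDerivAt.comp _ ?_ S.projection.hasFDerivAt
    rwa [S.centred, map_zero]
  rw [differentialAt_congr e, differentialAt_comp hd hG]
  have hdy : ∀ r, S.dy r = (EuclideanSpace.proj (S.e (.inr r)) :
      EuclideanSpace ℝ (Fin m) →L[ℝ] ℝ).comp (vectorDifferentialAt S.chart x₀) :=
    fun r => differentialAt_coord hd _
  simp only [hdy]
  ext v
  simp [sum_apply, projection_apply]

/-- Every covector is a combination of the `dx^i` and `dy^p`. -/
theorem exists_eq_sum (α : CotangentSpaceAt m M x₀) :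
    ∃ (c : Fin n ⊕ Fin n → ℝ) (d : Fin k → ℝ),
      α = ∑ i, c i • differentialAt (fun w => S.chart w (S.e (.inl i))) x₀
        + ∑ p, d p • S.dy p := by
  obtain ⟨c, hc⟩ := exists_eq_sum_differentialAt_coord S.chart_mem S.mem_source α
  refine ⟨fun i => c (S.e (.inl i)), fun p => c (S.e (.inr p)), ?_⟩
  rw [hc, ← S.e.sum_comp, Fintype.sum_sum_type]
  rfl

theorem dy_mem_ker (p : Fin k) : S.dy p ∈ LinearMap.ker (P.tensor x₀) := by
  rw [LinearMap.mem_ker]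
  refine LinearMap.ext fun α => ?_
  obtain ⟨c, d, rfl⟩ := S.exists_eq_sum α
  rw [P.skew]
  simp only [map_add, map_sum, map_smul, LinearMap.add_apply, LinearMap.sum_apply,
    LinearMap.smul_apply, tensor_dx_dy, tensor_dy_dy]
  simp

theorem linearIndependent_dy : LinearIndependent ℝ S.dy :=
  (linearIndependent_differentialAt_coord S.chart_mem S.mem_source).comp
    (fun p : Fin k => S.e (.inr p)) (S.e.injective.comp Sum.inr_injective)

/-- The covectors `dy^p` span the kernel of the Poisson tensor. -/
theorem span_dy : Submodule.span ℝ (Set.range S.dy) = LinearMap.ker (P.tensor x₀) := by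
  refine le_antisymm (Submodule.span_le.2 (Set.range_subset_iff.2 S.dy_mem_ker)) fun α hα => ?_
  obtain ⟨c, d, rfl⟩ := S.exists_eq_sum α
  have hdy : ∑ p, d p • S.dy p ∈ LinearMap.ker (P.tensor x₀) :=
    Submodule.sum_mem _ fun p _ => Submodule.smul_mem _ _ (S.dy_mem_ker p)
  have hβ := LinearMap.mem_ker.1 ((Submodule.add_mem_iff_left _ hdy).1 hα)
  have hxx : ∀ i j, P.tensor x₀ (differentialAt (fun w => S.chart w (S.e (.inl (.inl i)))) x₀)
      (differentialAt (fun w => S.chart w (S.e (.inl (.inl j)))) x₀) = 0 :=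
    fun i j => S.bracket_x_x i j x₀ S.mem_source
  have hxx' : ∀ i j, P.tensor x₀ (differentialAt (fun w => S.chart w (S.e (.inl (.inl i)))) x₀)
      (differentialAt (fun w => S.chart w (S.e (.inl (.inr j)))) x₀) = if i = j then 1 else 0 :=
    fun i j => S.bracket_x_x' i j x₀ S.mem_source
  have hx'x' : ∀ i j, P.tensor x₀ (differentialAt (fun w => S.chart w (S.e (.inl (.inr i)))) x₀)
      (differentialAt (fun w => S.chart w (S.e (.inl (.inr j)))) x₀) = 0 :=
    fun i j => S.bracket_x'_x' i j x₀ S.mem_source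
  have hx'x : ∀ i j, P.tensor x₀ (differentialAt (fun w => S.chart w (S.e (.inl (.inr i)))) x₀)
      (differentialAt (fun w => S.chart w (S.e (.inl (.inl j)))) x₀) =
        -if j = i then 1 else 0 := fun i j => by rw [P.skew, hxx']
  -- Pairing the `dx`-part with the conjugate coordinate differential isolates one coefficient, up
  -- to sign.
  have hc : c = 0 := by
    funext i
    rcases i with i | i
    · have h1 := DFunLike.congr_fun hβ (differentialAt (fun w => S.chart w (S.e (.inl (.inr i)))) x₀)
      simpa [LinearMap.sum_apply, hxx', hx'x'] using h1
    · have h1 := DFunLike.congr_fun hβ (differentialAt (fun w => S.chart w (S.e (.inl (.inl i)))) x₀)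
      simpa [LinearMap.sum_apply, hxx, hx'x] using h1
  rw [hc]
  simp only [Pi.zero_apply, zero_smul, Finset.sum_const_zero, zero_add]
  exact Submodule.sum_mem _ fun p _ =>
    Submodule.smul_mem _ _ (Submodule.subset_span (Set.mem_range_self p))

end SplittingCoordinates

/-! ### The Lie algebra as the kernel with the bracket of differentials -/

namespace SplittingCoordinates

variable {m : ℕ} {M : Type*} [TopologicalSpace M] [ChartedSpace (EuclideanSpace ℝ (Fin m)) M]
  {P : PoissonTensor m M} {x₀ : M} {n k : ℕ} (S : SplittingCoordinates P x₀ n k)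
  {V : Type*} [AddCommGroup V] [Module ℝ V] (b : Module.Basis (Fin k) ℝ V)

/-- The function `u_p y^p` attached to the vector `u = u_p b^p`. -/
noncomputable def linearFunction (u : V) : M → ℝ := fun w => ∑ p, b.repr u p * S.y p w

/-- The linear map `u_p b^p ↦ u_p dy^p`. -/
noncomputable def toCotangent : V →ₗ[ℝ] CotangentSpaceAt m M x₀ := b.constr ℝ S.dy

theorem toCotangent_apply (u : V) : S.toCotangent b u = ∑ p, b.repr u p • S.dy p := by
  rw [toCotangent, Module.Basis.constr_apply_fintype]
  rfl

theorem smoothNear_linearFunction (u : V) : SmoothNear m (S.linearFunction b u) x₀ :=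
  SmoothNear.sum_mul _ S.smoothNear_y

theorem differentialAt_linearFunction (u : V) :
    differentialAt (S.linearFunction b u) x₀ = S.toCotangent b u := by
  rw [toCotangent_apply]
  exact differentialAt_sum_mul _ fun p => (S.smoothNear_y p).mdifferentiableAt

variable [IsManifold (𝓡 m) ∞ M]

/-- The right-hand side does not involve the coordinates, which is what links two splitting systems.
-/
theorem range_toCotangent :
    LinearMap.range (S.toCotangent b) = LinearMap.ker (P.tensor x₀) := by
  rw [toCotangent, Module.Basis.constr_range, span_dy]

theorem toCotangent_mem_ker (u : V) : S.toCotangent b u ∈ LinearMap.ker (P.tensor x₀) := by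
  rw [← S.range_toCotangent b]
  exact LinearMap.mem_range_self _ u

theorem toCotangent_injective : Function.Injective (S.toCotangent b) := by
  refine (injective_iff_map_eq_zero _).2 fun u hu => b.repr.map_eq_zero_iff.1 (Finsupp.ext ?_)
  rw [toCotangent_apply] at hu
  exact Fintype.linearIndependent_iff.1 S.linearIndependent_dy _ hu

variable {C : Fin k → Fin k → Fin k → ℝ}

/-- The bilinear product on `V` with the structure constants `C` corresponds to the Poisson
bracket of functions. -/
theorem toCotangent_product (hC : IsLinearPart S.h C) (B : V →ₗ[ℝ] V →ₗ[ℝ] V)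
    (hB : ∀ p q, B (b p) (b q) = ∑ r, C p q r • b r) (u v : V) :
    S.toCotangent b (B u v) =
      differentialAt (P.bracket (S.linearFunction b u) (S.linearFunction b v)) x₀ := by
  have hb : ∀ r, S.toCotangent b (b r) = S.dy r := fun r => b.constr_basis ℝ _ r
  have h1 : differentialAt (m := m) (P.bracket (S.linearFunction b u) (S.linearFunction b v)) x₀ =
      ∑ q, b.repr v q • ∑ p, b.repr u p • ∑ r, C p q r • S.dy r := by
    refine (P.differentialAt_bracket_sum_right (b.repr v) S.smoothNear_y
      (S.smoothNear_linearFunction b u)).trans (Finset.sum_congr rfl fun q _ => ?_)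
    refine congrArg _ ((P.differentialAt_bracket_sum_left (b.repr u) S.smoothNear_y
      (S.smoothNear_y q)).trans ?_)
    simp_rw [S.differentialAt_bracket_y hC]
  rw [h1]
  conv_lhs => rw [← b.sum_repr u, ← b.sum_repr v]
  simp only [map_sum, map_smul, LinearMap.sum_apply, LinearMap.smul_apply, hB, hb]

/-- A bare bilinear `B` is used because this identity serves to construct the Lie bracket. -/
theorem product_skew (hC : IsLinearPart S.h C) (B : V →ₗ[ℝ] V →ₗ[ℝ] V)
    (hB : ∀ p q, B (b p) (b q) = ∑ r, C p q r • b r) (u v : V) : B u v = -B v u := by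
  apply S.toCotangent_injective b
  rw [map_neg, S.toCotangent_product b hC B hB, S.toCotangent_product b hC B hB,
    P.differentialAt_bracket_skew]

/-- The linear function of `B u v` and the bracket of the linear functions of `u` and `v` may
differ, but they have the same differential at `x₀`, in the kernel, so they are interchangeable in
an outer bracket. -/
theorem toCotangent_product_product (hC : IsLinearPart S.h C) (B : V →ₗ[ℝ] V →ₗ[ℝ] V)
    (hB : ∀ p q, B (b p) (b q) = ∑ r, C p q r • b r) (u v w : V) :
    S.toCotangent b (B (B u v) w) = differentialAt (P.bracket
      (P.bracket (S.linearFunction b u) (S.linearFunction b v)) (S.linearFunction b w)) x₀ := by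
  rw [S.toCotangent_product b hC B hB]
  refine P.differentialAt_bracket_congr (S.smoothNear_linearFunction b _)
    ((S.smoothNear_linearFunction b u).bracket P (S.smoothNear_linearFunction b v))
    (S.smoothNear_linearFunction b w) (S.smoothNear_linearFunction b w) ?_ rfl ?_ ?_
  · rw [differentialAt_linearFunction, S.toCotangent_product b hC B hB]
  · rw [differentialAt_linearFunction]; exact S.toCotangent_mem_ker b _
  · rw [differentialAt_linearFunction]; exact S.toCotangent_mem_ker b _

/-- The Jacobi identity for functions holds on a neighbourhood of `x₀`, so it may be differentiated
there. -/
theorem product_jacobi (hC : IsLinearPart S.h C) (B : V →ₗ[ℝ] V →ₗ[ℝ] V)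
    (hB : ∀ p q, B (b p) (b q) = ∑ r, C p q r • b r) (u v w : V) :
    B (B u v) w + B (B v w) u + B (B w u) v = 0 := by
  apply S.toCotangent_injective b
  rw [map_add, map_add, map_zero]
  simp only [S.toCotangent_product_product b hC B hB]
  have hu := S.smoothNear_linearFunction b u
  have hv := S.smoothNear_linearFunction b v
  have hw := S.smoothNear_linearFunction b w
  have h := differentialAt_sum_mul (m := m) (fun _ : Fin 3 => (1 : ℝ))
    (f := ![P.bracket (P.bracket (S.linearFunction b u) (S.linearFunction b v))
        (S.linearFunction b w),
      P.bracket (P.bracket (S.linearFunction b v) (S.linearFunction b w)) (S.linearFunction b u),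
      P.bracket (P.bracket (S.linearFunction b w) (S.linearFunction b u)) (S.linearFunction b v)])
    (x := x₀) (by
      intro i
      fin_cases i
      · exact ((hu.bracket P hv).bracket P hw).mdifferentiableAt
      · exact ((hv.bracket P hw).bracket P hu).mdifferentiableAt
      · exact ((hw.bracket P hu).bracket P hv).mdifferentiableAt)
  simp only [Fin.sum_univ_three, one_mul, one_smul, Matrix.cons_val_zero, Matrix.cons_val_one,
    Matrix.cons_val] at h
  rw [← h, differentialAt_congr (g := fun _ => 0) (P.bracket_jacobi hu hv hw)]
  exact mfderiv_const

/-- The linear part of the transverse Poisson tensor is a system of structure constants. -/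
theorem exists_lieAlgebra (hC : IsLinearPart S.h C) :
    ∃ (L : Type) (_ : LieRing L) (_ : LieAlgebra ℝ L) (b : Module.Basis (Fin k) ℝ L),
      HasStructureConstants b C := by
  let b := EuclideanSpace.basisFun (Fin k) ℝ |>.toBasis
  let B : EuclideanSpace ℝ (Fin k) →ₗ[ℝ] EuclideanSpace ℝ (Fin k) →ₗ[ℝ] EuclideanSpace ℝ (Fin k) :=
    b.constr ℝ fun p => b.constr ℝ fun q => ∑ r, C p q r • b r
  have hB : ∀ p q, B (b p) (b q) = ∑ r, C p q r • b r := fun p q => by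
    simp only [B, Module.Basis.constr_basis]
  let instLieRing : LieRing (EuclideanSpace ℝ (Fin k)) :=
    { bracket := fun u v => B u v
      add_lie := fun u v w => by simp
      lie_add := fun u v w => by simp
      lie_self := fun u => by
        have h : (2 : ℝ) • B u u = 0 := by
          rw [two_smul]
          exact add_eq_zero_iff_eq_neg.2 (S.product_skew b hC B hB u u)
        exact (smul_eq_zero_iff_right two_ne_zero).1 h
      leibniz_lie := fun u v w => by
        have h := S.product_jacobi b hC B hB u v w
        have h1 : B (B w u) v = B v (B u w) := by
          rw [S.product_skew b hC B hB (B w u) v, S.product_skew b hC B hB w u, map_neg, neg_neg]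
        rw [S.product_skew b hC B hB (B v w) u, h1] at h
        change B u (B v w) = B (B u v) w + B v (B u w)
        rw [← sub_eq_zero, ← neg_eq_zero, ← h]
        abel }
  let instLieAlgebra : LieAlgebra ℝ (EuclideanSpace ℝ (Fin k)) :=
    { lie_smul := fun t u v => (B u).map_smul t v }
  exact ⟨EuclideanSpace ℝ (Fin k), instLieRing, instLieAlgebra, b, hB⟩

/-- The Lie algebras of two systems of splitting coordinates at a point are isomorphic. -/
theorem nonempty_lieEquiv {n' k' : ℕ} (S' : SplittingCoordinates P x₀ n' k')
    {C' : Fin k' → Fin k' → Fin k' → ℝ} (hC : IsLinearPart S.h C) (hC' : IsLinearPart S'.h C')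
    {L L' : Type*} [LieRing L] [LieAlgebra ℝ L] [LieRing L'] [LieAlgebra ℝ L']
    {b : Module.Basis (Fin k) ℝ L} {b' : Module.Basis (Fin k') ℝ L'}
    (hb : HasStructureConstants b C) (hb' : HasStructureConstants b' C') :
    Nonempty (L ≃ₗ⁅ℝ⁆ L') := by
  -- Both cotangent maps are isomorphisms onto the same kernel; `T` is one followed by the inverse
  -- of the other.
  let T : L ≃ₗ[ℝ] L' := (LinearEquiv.ofInjective _ (S.toCotangent_injective b)).trans
    ((LinearEquiv.ofEq _ _ ((S.range_toCotangent b).trans (S'.range_toCotangent b').symm)).trans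
      (LinearEquiv.ofInjective _ (S'.toCotangent_injective b')).symm)
  have hT : ∀ u, S'.toCotangent b' (T u) = S.toCotangent b u := by
    intro u
    rw [← LinearEquiv.ofInjective_apply (h := S'.toCotangent_injective b')]
    simp [T]
  have hlie : ∀ u v, S.toCotangent b ⁅u, v⁆ =
      differentialAt (P.bracket (S.linearFunction b u) (S.linearFunction b v)) x₀ :=
    -- `LieModule.toEnd` is the Lie bracket as a bilinear map.
    S.toCotangent_product b hC (LieModule.toEnd ℝ L L : L →ₗ[ℝ] L →ₗ[ℝ] L) hb
  have hlie' : ∀ u v, S'.toCotangent b' ⁅u, v⁆ =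
      differentialAt (P.bracket (S'.linearFunction b' u) (S'.linearFunction b' v)) x₀ :=
    S'.toCotangent_product b' hC' (LieModule.toEnd ℝ L' L' : L' →ₗ[ℝ] L' →ₗ[ℝ] L') hb'
  refine ⟨{ T with map_lie' := fun {u v} => S'.toCotangent_injective b' ?_ }⟩
  change S'.toCotangent b' (T ⁅u, v⁆) = S'.toCotangent b' ⁅T u, T v⁆
  rw [hT, hlie, hlie']
  -- The linear functions of `u` and of `T u` have equal differentials at `x₀`, by the choice of
  -- `T`.
  refine P.differentialAt_bracket_congr (S.smoothNear_linearFunction b u)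
    (S'.smoothNear_linearFunction b' _) (S.smoothNear_linearFunction b v)
    (S'.smoothNear_linearFunction b' _) ?_ ?_ ?_ ?_
  · rw [differentialAt_linearFunction, differentialAt_linearFunction, hT]
  · rw [differentialAt_linearFunction, differentialAt_linearFunction, hT]
  · rw [differentialAt_linearFunction]; exact S.toCotangent_mem_ker b _
  · rw [differentialAt_linearFunction]; exact S.toCotangent_mem_ker b _

end SplittingCoordinates

theorem lemma3 {m : ℕ} {M : Type*} [TopologicalSpace M]
    [ChartedSpace (EuclideanSpace ℝ (Fin m)) M] [IsManifold (𝓡 m) ∞ M]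
    (P : PoissonTensor m M) (x₀ : M) :
    -- In all splitting coordinates at `x₀`, the transverse tensor has a unique linear part `C`,
    -- and `C` is the system of structure constants of a Lie algebra with basis `e^1, …, e^k`.
    (∀ (n k : ℕ) (S : SplittingCoordinates P x₀ n k),
      (∃! C : Fin k → Fin k → Fin k → ℝ, IsLinearPart S.h C) ∧
      ∀ C : Fin k → Fin k → Fin k → ℝ, IsLinearPart S.h C →
        ∃ (L : Type) (_ : LieRing L) (_ : LieAlgebra ℝ L) (b : Module.Basis (Fin k) ℝ L),
          HasStructureConstants b C) ∧
    -- The Lie algebras obtained from any two systems of splitting coordinates at `x₀` are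
    -- isomorphic.
    (∀ (n k n' k' : ℕ) (S : SplittingCoordinates P x₀ n k) (S' : SplittingCoordinates P x₀ n' k')
      (C : Fin k → Fin k → Fin k → ℝ) (C' : Fin k' → Fin k' → Fin k' → ℝ),
      IsLinearPart S.h C → IsLinearPart S'.h C' →
      ∀ (L L' : Type*) [LieRing L] [LieAlgebra ℝ L] [LieRing L'] [LieAlgebra ℝ L']
        (b : Module.Basis (Fin k) ℝ L) (b' : Module.Basis (Fin k') ℝ L'),
        HasStructureConstants b C → HasStructureConstants b' C' →
        Nonempty (L ≃ₗ⁅ℝ⁆ L')) := by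
  exact ⟨fun n k S => ⟨S.existsUnique_isLinearPart, fun C hC => S.exists_lieAlgebra hC⟩,
    fun n k n' k' S S' C C' hC hC' L L' _ _ _ _ b b' hb hb' =>
      S.nonempty_lieEquiv S' hC hC' hb hb'⟩
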